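/- Let $1<k<\infty$, let $X=\Delta_k$ be the metric space consisting of $k$ points at pairwise distances $1$, and let $Y\subset\mathbb R^{k-1}$ be a compact convex set with non-empty interior and Euclidean diameter $1$ whose boundary is smooth, in the sense that exactly one supporting hyperplane of $Y$ passes through each boundary point of $Y$; regard $Y$ as a metric space with the Euclidean distance. For (non-empty) metric spaces $A,B$ let $d_{GH}(A,B)\in[0,\infty]$ be the Gromov--Hausdorff distance, i.e. the infimum of the Hausdorff distances between $A'$ and $B'$ over all metric spaces $Z$ and all subsets $A',B'\subset Z$ isometric to $A$ and $B$. If $d_{GH}(A,B)<\infty$, the metric segment $[A,B]$ is the class of all metric spaces $W$ with $d_{GH}(A,W)+d_{GH}(W,B)=d_{GH}(A,B)$. The segment $[A,B]$ can be extended beyond $B$ if there is a metric space $Z$ with $d_{GH}(A,Z)<\infty$, $B\in[A,Z]$ and $d_{GH}(B,Z)>0$; extendability beyond $A$ is defined symmetrically, using $[A,B]=[B,A]$. For bounded $A,B$, the segment $[A,B]$ is extreme if $2d_{GH}(A,B)=\operatorname{diam}A=\operatorname{diam}B>0$. Let $\alpha_k(Y)$ be the supremum, over all partitions $Y=Y_1\sqcup\dots\sqcup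 Y_k$ into $k$ non-empty sets, of $\min_{i\ne j}\inf\{|yy'|:y\in Y_i,\ y'\in Y_j\}$, and let $d_k(Y)$ be the infimum over the same partitions of $\max_i\operatorname{diam}Y_i$. Then: 1. $\alpha_k(Y)=0$; 2. $d_k(Y)<1$; 3. $2d_{GH}(\Delta_k,Y)=1$; 4. the metric segment $[X,Y]$ is extreme; 5. $[X,Y]$ can be extended beyond $X$; 6. $[X,Y]$ cannot be extended beyond $Y$. -/

import Mathlib

open scoped ENNReal

universe u v w

/-! ### The Gromov–Hausdorff distance between arbitrary metric spaces -/

/-- The Gromov–Hausdorff distance `d_GH(X, Y) ∈ [0, ∞]` of two metric spaces: the infimum of the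
Hausdorff distances `d_H(X', Y')` over all realizations `(X', Y', Z)` of the pair `(X, Y)`, where
`Z` is a metric space and `X', Y' ⊆ Z` are isometric copies of `X` and `Y`.
(Replacing `Z` by its subspace `X' ∪ Y'` shows that no larger universe has to be considered.) -/
noncomputable def ghEDist (X : Type u) (Y : Type v) [MetricSpace X] [MetricSpace Y] : ℝ≥0∞ :=
  ⨅ (Z : Type (max u v)) (_ : MetricSpace Z) (f : X → Z) (g : Y → Z)
    (_ : Isometry f) (_ : Isometry g),
    Metric.hausdorffEDist (Set.range f) (Set.range g)

/-- The diameter of a metric space, as an element of `[0, ∞]`. -/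
noncomputable def ediamSpace (X : Type u) [MetricSpace X] : ℝ≥0∞ :=
  Metric.ediam (Set.univ : Set X)

/-! ### Metric segments -/

/-- `W` belongs to the metric segment `[X, Y]`, that is, `d_GH(X, Y) < ∞` (so that the segment
is defined) and `W` lies between `X` and `Y`. -/
def MemMetricSegment (X : Type u) (Y : Type v) (W : Type w)
    [MetricSpace X] [MetricSpace Y] [MetricSpace W] : Prop :=
  ghEDist X Y < ∞ ∧ ghEDist X W + ghEDist W Y = ghEDist X Y

/-- The metric segment `[X, Y]` can be extended beyond its end-point `Y`: there is a (non-empty)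
metric space `Z` such that `[X, Z]` contains `Y` and `d_GH(Y, Z) > 0`.
The universe parameter given first is the one in which `Z` is sought. -/
def ExtendableBeyond.{w', u', v'} (X : Type u') (Y : Type v')
    [MetricSpace X] [MetricSpace Y] : Prop :=
  ∃ (Z : Type w') (_ : MetricSpace Z) (_ : Nonempty Z),
    MemMetricSegment X Z Y ∧ 0 < ghEDist Y Z

/-- The metric segment `[X, Y]` between bounded spaces is extreme (`X` and `Y` are mutually
hyperextreme): `2 d_GH(X, Y) = diam Y = diam X > 0`. -/
structure IsExtremeSegment (X : Type u) (Y : Type v) [MetricSpace X] [MetricSpace Y] : Prop where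
  bounded_left : ediamSpace X < ∞
  bounded_right : ediamSpace Y < ∞
  two_mul_ghEDist : 2 * ghEDist X Y = ediamSpace Y
  diam_eq : ediamSpace Y = ediamSpace X
  diam_pos : 0 < ediamSpace X

/-! ### Partitions of a metric space into `m` parts -/

/-- The indexed family `D` is a partition of `X` into non-empty, pairwise disjoint subsets. -/
structure IsPartitionOf {X : Type u} {ι : Type v} (D : ι → Set X) : Prop where
  nonempty : ∀ i, (D i).Nonempty
  disjoint : ∀ i j, i ≠ j → Disjoint (D i) (D j)
  cover : ⋃ i, D i = Set.univ

/-- `diam D`, the supremum of the diameters of the members of the family `D`. -/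
noncomputable def familyDiam {X : Type u} [MetricSpace X] {ι : Type v} (D : ι → Set X) : ℝ≥0∞ :=
  ⨆ i, Metric.ediam (D i)

/-- The distance `|AB| = inf {|ab| : a ∈ A, b ∈ B}` between two subsets. -/
noncomputable def setInfEDist {X : Type u} [MetricSpace X] (A B : Set X) : ℝ≥0∞ :=
  ⨅ a ∈ A, ⨅ b ∈ B, edist a b

/-- `α(D)`, the infimum of the distances between distinct members of the family `D`. -/
noncomputable def familyAlpha {X : Type u} [MetricSpace X] {ι : Type v} (D : ι → Set X) : ℝ≥0∞ :=
  ⨅ (i : ι) (j : ι) (_ : i ≠ j), setInfEDist (D i) (D j)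

/-- `d_m(X)`, the infimum of `diam D` over the partitions `D` of `X` into `m` subsets. -/
noncomputable def partitionDiam (m : ℕ) (X : Type u) [MetricSpace X] : ℝ≥0∞ :=
  ⨅ (D : Fin m → Set X) (_ : IsPartitionOf D), familyDiam D

/-- `α_m(X)`, the supremum of `α(D)` over the partitions `D` of `X` into `m` subsets. -/
noncomputable def partitionAlpha (m : ℕ) (X : Type u) [MetricSpace X] : ℝ≥0∞ :=
  ⨆ (D : Fin m → Set X) (_ : IsPartitionOf D), familyAlpha D

/-! ### The unit simplex `Δ_k` -/

/-- The points of the metric space `Δ_k` that consists of `k` points at mutual distances `1`. -/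
def UnitSimplex (k : ℕ) : Type := Fin k

instance (k : ℕ) : DecidableEq (UnitSimplex k) := inferInstanceAs (DecidableEq (Fin k))

noncomputable instance (k : ℕ) : MetricSpace (UnitSimplex k) where
  dist x y := if x = y then 0 else 1
  dist_self x := by simp
  dist_comm x y := by simp [eq_comm]
  dist_triangle x y z := by
    have h : ∀ a b : UnitSimplex k, (0 : ℝ) ≤ if a = b then 0 else 1 := by
      intro a b; split_ifs <;> norm_num
    by_cases h1 : x = y
    · subst h1; simp
    · have h2 := h y z
      simp only [h1, if_false]
      split_ifs at h2 ⊢ <;> norm_num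
  eq_of_dist_eq_zero := by
    intro x y h
    by_contra hne
    simp [hne] at h

/-! ### Convex bodies with smooth boundary -/

/-- `n` is an outer unit normal of `K` at `x`: the hyperplane through `x` orthogonal to the unit
vector `n` supports `K`, and `K` lies in the half-space that `n` points away from. -/
def IsOuterUnitNormal {E : Type u} [NormedAddCommGroup E] [InnerProductSpace ℝ E]
    (K : Set E) (x n : E) : Prop :=
  ‖n‖ = 1 ∧ ∀ y ∈ K, inner ℝ n y ≤ inner ℝ n x

/-- A convex body (compact, convex, with non-empty interior) is smooth if there is exactly one
supporting hyperplane through each of its boundary points. Since the interior is non-empty,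
supporting hyperplanes through `x` correspond bijectively to outer unit normals at `x`. -/
structure IsSmoothConvexBody {E : Type u} [NormedAddCommGroup E] [InnerProductSpace ℝ E]
    (K : ConvexBody E) : Prop where
  interior_nonempty : (interior (K : Set E)).Nonempty
  unique_normal : ∀ x ∈ frontier (K : Set E), ∃! n : E, IsOuterUnitNormal (K : Set E) x n

/-! ### Gromov–Hausdorff distance and correspondences -/

section Correspondences

variable {X : Type u} {Y : Type v} [MetricSpace X] [MetricSpace Y]

/-! Everything is read off from distortions of correspondences. As `Y` is connected, a
correspondence with a space whose distinct points are at least `l` apart has distortion at least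
`l`; for diameters at most `1` the full relation gives the matching bound, so `2 * d_GH(Δ_k, Y) =
1`. Connectedness also gives `α_k(Y) = 0`.

Beyond `Δ_k` the segment continues to the simplex with doubled distances, since `1/2 + 1/2 = 1`.

Beyond `Y` it stops because `d_k(Y) < 1`, a Hadwiger-type argument: `k` directions positively span
`ℝ^(k-1)`, so they illuminate a smooth body; two points illuminated by the same direction can be
translated together into the interior, so they do not realize the diameter. Compactness makes this
uniform on `k` parts. Such a partition composed with a near-optimal correspondence from `Y` to `Z`
gives `d_GH(Δ_k, Z) < 1/2 + d_GH(Y, Z)`. -/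

theorem ghEDist_le_of_correspondence [Nonempty X] (R : X → Y → Prop) {r : ℝ} (hr : 0 < r)
    (hl : ∀ x, ∃ y, R x y) (hs : ∀ y, ∃ x, R x y)
    (hd : ∀ x y x' y', R x y → R x' y' → |dist x x' - dist y y'| ≤ 2 * r) :
    ghEDist X Y ≤ ENNReal.ofReal r := by
  let Φ : {p : X × Y // R p.1 p.2} → X := fun p => p.1.1
  let Ψ : {p : X × Y // R p.1 p.2} → Y := fun p => p.1.2
  have : Nonempty {p : X × Y // R p.1 p.2} := by
    obtain ⟨x⟩ := ‹Nonempty X›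
    obtain ⟨y, hy⟩ := hl x
    exact ⟨⟨(x, y), hy⟩⟩
  -- Related points are glued at distance exactly `r`; `r > 0` makes this a genuine metric on the
  -- disjoint union.
  let m : MetricSpace (X ⊕ Y) :=
    Metric.glueMetricApprox Φ Ψ r hr fun p q => hd _ _ _ _ p.2 q.2
  have hglue : ∀ x y, R x y → edist (Sum.inl x : X ⊕ Y) (Sum.inr y) = ENNReal.ofReal r := by
    intro x y h
    rw [edist_dist]
    exact congrArg ENNReal.ofReal (Metric.glueDist_glued_points Φ Ψ r ⟨(x, y), h⟩)
  have hinl : Isometry (Sum.inl : X → X ⊕ Y) := Isometry.of_dist_eq fun _ _ => rfl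
  have hinr : Isometry (Sum.inr : Y → X ⊕ Y) := Isometry.of_dist_eq fun _ _ => rfl
  refine (iInf₂_le (X ⊕ Y) m).trans <| (iInf₂_le Sum.inl Sum.inr).trans <|
    (iInf₂_le hinl hinr).trans ?_
  refine Metric.hausdorffEDist_le_of_mem_edist ?_ ?_
  · rintro _ ⟨x, rfl⟩
    obtain ⟨y, h⟩ := hl x
    exact ⟨_, ⟨y, rfl⟩, (hglue x y h).le⟩
  · rintro _ ⟨y, rfl⟩
    obtain ⟨x, h⟩ := hs y
    exact ⟨_, ⟨x, rfl⟩, by rw [edist_comm]; exact (hglue x y h).le⟩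

theorem exists_correspondence_of_ghEDist_lt {r : ℝ} (h : ghEDist X Y < ENNReal.ofReal r) :
    ∃ R : X → Y → Prop, (∀ x, ∃ y, R x y) ∧ (∀ y, ∃ x, R x y) ∧
      ∀ x y x' y', R x y → R x' y' → |dist x x' - dist y y'| < 2 * r := by
  simp only [ghEDist, iInf_lt_iff] at h
  obtain ⟨Z, _, f, g, hf, hg, h⟩ := h
  have key : ∀ a b : Z, edist a b < ENNReal.ofReal r → dist a b < r := by
    intro a b hab
    rw [edist_dist] at hab
    exact (ENNReal.ofReal_lt_ofReal_iff_of_nonneg dist_nonneg).1 hab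
  refine ⟨fun x y => dist (f x) (g y) < r, fun x => ?_, fun y => ?_, ?_⟩
  · obtain ⟨_, ⟨y, rfl⟩, hy⟩ := Metric.exists_edist_lt_of_hausdorffEDist_lt (Set.mem_range_self x) h
    exact ⟨y, key _ _ hy⟩
  · rw [Metric.hausdorffEDist_comm] at h
    obtain ⟨_, ⟨x, rfl⟩, hx⟩ := Metric.exists_edist_lt_of_hausdorffEDist_lt (Set.mem_range_self y) h
    exact ⟨x, key _ _ (by rwa [edist_comm])⟩
  · intro x y x' y' h₁ h₂
    rw [← hf.dist_eq x x', ← hg.dist_eq y y', abs_lt]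
    have h₃ := dist_triangle4 (f x) (g y) (g y') (f x')
    have h₄ := dist_triangle4 (g y) (f x) (f x') (g y')
    rw [dist_comm (g y') (f x')] at h₃
    rw [dist_comm (g y) (f x)] at h₄
    constructor <;> linarith

theorem ghEDist_le_symm : ghEDist Y X ≤ ghEDist X Y := by
  refine le_iInf₂ fun Z _ => le_iInf₂ fun f g => le_iInf₂ fun hf hg => ?_
  rw [Metric.hausdorffEDist_comm]
  exact (iInf₂_le Z ‹_›).trans <| (iInf₂_le g f).trans (iInf₂_le hg hf)

theorem ghEDist_comm : ghEDist X Y = ghEDist Y X :=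
  le_antisymm ghEDist_le_symm ghEDist_le_symm

/-- The full relation is a correspondence. -/
theorem ghEDist_le_of_dist_le [Nonempty X] [Nonempty Y] {r : ℝ} (hr : 0 < r)
    (hX : ∀ x x' : X, dist x x' ≤ 2 * r) (hY : ∀ y y' : Y, dist y y' ≤ 2 * r) :
    ghEDist X Y ≤ ENNReal.ofReal r := by
  obtain ⟨x₀⟩ := ‹Nonempty X›
  obtain ⟨y₀⟩ := ‹Nonempty Y›
  have : Nonempty X := ⟨x₀⟩
  refine ghEDist_le_of_correspondence (fun _ _ => True) hr (fun _ => ⟨y₀, trivial⟩)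
    (fun _ => ⟨x₀, trivial⟩) fun x y x' y' _ _ => abs_sub_le_iff.2 ⟨?_, ?_⟩
  · linarith [hX x x', dist_nonneg (x := y) (y := y')]
  · linarith [hY y y', dist_nonneg (x := x) (y := x')]

/-- With distortion below `l`, nearby points of `Y` have the same partner, so the partner map is
locally constant, hence constant, yet it must reach two points. -/
theorem le_ghEDist_of_separated_of_preconnected [Nontrivial X] [PreconnectedSpace Y] {l : ℝ}
    (hX : ∀ x x' : X, x ≠ x' → l ≤ dist x x') : ENNReal.ofReal (l / 2) ≤ ghEDist X Y := by
  by_contra! hlt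
  -- An intermediate `q` leaves a positive radius `l - 2 * q` on which partners agree.
  obtain ⟨q, hq, hq'⟩ := ENNReal.lt_iff_exists_nnreal_btwn.1 hlt
  have hql : (q : ℝ) < l / 2 := by
    rw [← ENNReal.ofReal_coe_nnreal] at hq'
    exact (ENNReal.ofReal_lt_ofReal_iff_of_nonneg q.2).1 hq'
  rw [← ENNReal.ofReal_coe_nnreal] at hq
  obtain ⟨R, hl, hs, hd⟩ := exists_correspondence_of_ghEDist_lt hq
  have hclose : ∀ x y x' y', R x y → R x' y' → dist y y' < l - 2 * q → x = x' := by
    intro x y x' y' h h' hyy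
    by_contra hne
    linarith [(abs_lt.1 (hd x y x' y' h h')).2, hX x x' hne]
  choose f hf using hs
  have hloc : IsLocallyConstant f := by
    rw [IsLocallyConstant.iff_eventually_eq]
    intro y
    filter_upwards [Metric.ball_mem_nhds y (show 0 < l - 2 * q by linarith)] with y' hy'
    exact hclose _ _ _ _ (hf y') (hf y) hy'
  have hfR : ∀ x y, R x y → f y = x := fun x y h =>
    hclose _ _ _ _ (hf y) h (by rw [dist_self]; linarith)
  obtain ⟨a, b, hab⟩ := exists_pair_ne X
  obtain ⟨ya, ha⟩ := hl a
  obtain ⟨yb, hb⟩ := hl b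
  exact hab (by rw [← hfR a ya ha, ← hfR b yb hb, hloc.apply_eq_of_preconnectedSpace ya yb])

theorem le_ghEDist_of_dist_le {a b : ℝ} (hX : ∀ x x' : X, dist x x' ≤ a) {y y' : Y}
    (hY : b ≤ dist y y') : ENNReal.ofReal ((b - a) / 2) ≤ ghEDist X Y := by
  by_contra! hlt
  obtain ⟨R, -, hs, hd⟩ := exists_correspondence_of_ghEDist_lt hlt
  obtain ⟨x, hx⟩ := hs y
  obtain ⟨x', hx'⟩ := hs y'
  linarith [(abs_lt.1 (hd x y x' y' hx hx')).1, hX x x']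

end Correspondences

/-! ### Partitions -/

theorem isPartitionOf_preimage_singleton {X : Type u} {ι : Type v} {f : X → ι}
    (hf : Function.Surjective f) : IsPartitionOf fun i => f ⁻¹' {i} where
  nonempty i := (hf i).imp fun _ h => h
  disjoint i j hij := by
    rw [Set.disjoint_left]
    intro x hx hx'
    exact hij ((Set.mem_singleton_iff.1 hx).symm.trans hx')
  cover := Set.eq_univ_of_forall fun x => Set.mem_iUnion.2 ⟨f x, rfl⟩

theorem partitionDiam_le {X : Type u} [MetricSpace X] {m : ℕ} {f : X → Fin m}
    (hf : Function.Surjective f) {r : ℝ} (hr : ∀ x x', f x = f x' → dist x x' ≤ r) :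
    partitionDiam m X ≤ ENNReal.ofReal r := by
  refine (iInf₂_le _ (isPartitionOf_preimage_singleton hf)).trans ?_
  refine iSup_le fun i => Metric.ediam_le fun x hx x' hx' => ?_
  rw [edist_dist]
  exact ENNReal.ofReal_le_ofReal (hr x x' (hx.trans hx'.symm))

theorem partitionAlpha_eq_zero_of_preconnected {X : Type u} [MetricSpace X] [PreconnectedSpace X]
    {m : ℕ} (hm : 1 < m) : partitionAlpha m X = 0 := by
  refine le_antisymm (iSup₂_le fun D hD => ?_) bot_le
  by_contra! hpos
  have hcov : ∀ x, ∃ i, x ∈ D i := fun x => Set.mem_iUnion.1 (hD.cover ▸ Set.mem_univ x)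
  choose f hf using hcov
  have hclose : ∀ i j x x', x ∈ D i → x' ∈ D j → edist x x' < familyAlpha D → i = j := by
    intro i j x x' hx hx' hlt
    by_contra hne
    refine hlt.not_ge ?_
    exact (iInf_le_of_le i <| iInf₂_le j hne).trans
      ((iInf₂_le x hx).trans (iInf₂_le x' hx'))
  have hloc : IsLocallyConstant f := by
    rw [IsLocallyConstant.iff_eventually_eq]
    intro x
    filter_upwards [Metric.eball_mem_nhds x hpos] with x' hx'
    exact hclose _ _ _ _ (hf x') (hf x) hx'
  have hfD : ∀ i x, x ∈ D i → f x = i := fun i x h =>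
    hclose _ _ _ _ (hf x) h (by rwa [edist_self])
  obtain ⟨a, ha⟩ := hD.nonempty ⟨0, by omega⟩
  obtain ⟨b, hb⟩ := hD.nonempty ⟨1, hm⟩
  have := hloc.apply_eq_of_preconnectedSpace a b
  rw [hfD _ a ha, hfD _ b hb] at this
  simp at this

theorem IsCompact.exists_forall_dist_le_of_lt {X : Type u} [PseudoMetricSpace X]
    {K : Set X} (hK : IsCompact K) {d : ℝ} (hd : 0 < d) (h : ∀ x ∈ K, ∀ y ∈ K, dist x y < d) : ∃ r, r < d ∧ ∀ x ∈ K, ∀ y ∈ K, dist x y ≤ r := by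
  rcases K.eq_empty_or_nonempty with rfl | hne
  · exact ⟨0, hd, by simp⟩
  · obtain ⟨p, hp, hmax⟩ := (hK.prod hK).exists_isMaxOn (hne.prod hne)
      (continuous_dist (α := X)).continuousOn
    exact ⟨dist p.1 p.2, h _ hp.1 _ hp.2, fun x hx y hy => hmax (Set.mk_mem_prod hx hy)⟩

/-! ### Illumination of smooth convex bodies -/

section Convex

variable {E : Type u} [NormedAddCommGroup E] [InnerProductSpace ℝ E]

theorem exists_pos_add_smul_mem_of_isOpen {s : Set E} (hs : IsOpen s) {x : E} (hx : x ∈ s)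
    (u : E) : ∃ t : ℝ, 0 < t ∧ x + t • u ∈ s := by
  have hcont : Filter.Tendsto (fun t : ℝ => x + t • u) (nhds 0) (nhds x) := by
    have : Continuous fun t : ℝ => x + t • u := by fun_prop
    simpa using this.tendsto 0
  have hev := (hcont.mono_left (nhdsWithin_le_nhds (s := Set.Ioi 0))).eventually
    (hs.mem_nhds hx)
  obtain ⟨t, ht, ht0⟩ := (hev.and self_mem_nhdsWithin).exists
  exact ⟨t, ht0, ht⟩

/-- A chord with an interior endpoint can be prolonged inside `K` past that endpoint. -/
theorem dist_lt_diam_of_mem_interior {K : Set E} (hK : Bornology.IsBounded K)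
    (hpos : 0 < Metric.diam K) {x y : E} (hx : x ∈ interior K) (hy : y ∈ K) :
    dist x y < Metric.diam K := by
  by_contra! hle
  obtain ⟨t, ht, hmem⟩ := exists_pos_add_smul_mem_of_isOpen isOpen_interior hx (x - y)
  have h := Metric.dist_le_diam_of_mem hK (interior_subset hmem) hy
  have heq : x + t • (x - y) - y = (1 + t) • (x - y) := by module
  rw [dist_eq_norm, heq, norm_smul, Real.norm_of_nonneg (by positivity), ← dist_eq_norm] at h
  nlinarith

/-- A boundary point is illuminated by every direction that makes an obtuse angle with the
outer normal, provided that the latter is unique. -/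
theorem exists_add_smul_mem_interior [CompleteSpace E] {K : Set E} (hK : Convex ℝ K)
    (hint : (interior K).Nonempty) {x n u : E} (hx : x ∈ K)
    (huniq : ∀ n', IsOuterUnitNormal K x n' → n' = n) (hu : inner ℝ n u < 0) :
    ∃ t : ℝ, 0 < t ∧ x + t • u ∈ interior K := by
  by_contra! hno
  have hconv : Convex ℝ ((fun t : ℝ => x + t • u) '' Set.Ioi 0) := by
    have : (fun t : ℝ => x + t • u) = AffineMap.lineMap x (x + u) := by
      ext t
      simp [AffineMap.lineMap_apply, add_comm]
    rw [this]
    exact (convex_Ioi 0).affine_image _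
  have hdisj : Disjoint (interior K) ((fun t : ℝ => x + t • u) '' Set.Ioi 0) := by
    rw [Set.disjoint_right]
    rintro _ ⟨t, ht, rfl⟩
    exact hno t ht
  -- If the ray misses the interior, a separating functional is maximal on `K` at `x` and
  -- nonnegative on `u`. Its Riesz vector, normalized, is an outer normal, hence equals `n`, against
  -- `hu`.
  obtain ⟨f, c, hf, hf'⟩ := geometric_hahn_banach_open hK.interior isOpen_interior hconv hdisj
  have hray : ∀ t : ℝ, 0 < t → c ≤ f x + t * f u := fun t ht => by
    simpa using hf' _ ⟨t, ht, rfl⟩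
  have hle : ∀ y ∈ K, f y ≤ c := by
    have hsub : closure (interior K) ⊆ {y | f y ≤ c} :=
      closure_minimal (fun y hy => (hf y hy).le) (isClosed_le f.continuous continuous_const)
    rw [hK.closure_interior_eq_closure_of_nonempty_interior hint] at hsub
    exact fun y hy => hsub (subset_closure hy)
  have hcx : c ≤ f x := by
    refine ge_of_tendsto (f := fun t : ℝ => f x + t * f u) (x := nhdsWithin 0 (Set.Ioi 0)) ?_
      (eventually_nhdsWithin_of_forall hray)
    have : Continuous fun t : ℝ => f x + t * f u := by fun_prop
    simpa using (this.tendsto 0).mono_left nhdsWithin_le_nhds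
  have hfu : 0 ≤ f u := by linarith [hray 1 one_pos, hle x hx]
  obtain ⟨p, hp⟩ := hint
  set v := (InnerProductSpace.toDual ℝ E).symm f with hv
  have hvf : ∀ y, inner ℝ v y = f y := fun y => InnerProductSpace.toDual_symm_apply
  have hv0 : v ≠ 0 := by
    intro h0
    have h1 := hvf p
    have h2 := hvf x
    rw [h0, inner_zero_left] at h1 h2
    linarith [hf p hp]
  have hvpos : 0 < ‖v‖ := norm_pos_iff.2 hv0
  have hn : IsOuterUnitNormal K x (‖v‖⁻¹ • v) := by
    refine ⟨?_, fun y hy => ?_⟩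
    · rw [norm_smul, norm_inv, norm_norm, inv_mul_cancel₀ hvpos.ne']
    · rw [real_inner_smul_left, real_inner_smul_left, hvf, hvf]
      exact mul_le_mul_of_nonneg_left ((hle y hy).trans hcx) (by positivity)
  rw [← huniq _ hn, real_inner_smul_left, hvf] at hu
  exact absurd hu (not_lt.2 (by positivity))

/-- If finitely many directions positively span the space, then every point of a smooth convex
body is illuminated by one of them. -/
theorem IsSmoothConvexBody.exists_add_smul_mem_interior [CompleteSpace E] {K : ConvexBody E}
    (hK : IsSmoothConvexBody K) {ι : Type v} [Nonempty ι] {u : ι → E}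
    (hu : ∀ n : E, n ≠ 0 → ∃ i, inner ℝ n (u i) < 0) {x : E} (hx : x ∈ (K : Set E)) :
    ∃ i, ∃ t : ℝ, 0 < t ∧ x + t • u i ∈ interior (K : Set E) := by
  by_cases hxi : x ∈ interior (K : Set E)
  · obtain ⟨i⟩ := ‹Nonempty ι›
    exact ⟨i, exists_pos_add_smul_mem_of_isOpen isOpen_interior hxi _⟩
  · obtain ⟨n, hn, huniq⟩ := hK.unique_normal x ⟨subset_closure hx, hxi⟩
    obtain ⟨i, hi⟩ := hu n (by rintro rfl; simpa using hn.1)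
    exact ⟨i, _root_.exists_add_smul_mem_interior K.convex hK.interior_nonempty hx huniq hi⟩

/-- By convexity shorter positive steps also enter the interior, so both points can take the common
step `min s t`, which preserves their distance. -/
theorem dist_lt_diam_of_add_smul_mem_interior {K : Set E} (hK : Convex ℝ K)
    (hb : Bornology.IsBounded K) (hpos : 0 < Metric.diam K) {x y u : E} (hx : x ∈ K) (hy : y ∈ K)
    {s t : ℝ} (hs : 0 < s) (ht : 0 < t) (hxs : x + s • u ∈ interior K)
    (hyt : y + t • u ∈ interior K) : dist x y < Metric.diam K := by
  have key : ∀ z ∈ K, ∀ r : ℝ, z + r • u ∈ interior K → ∀ q, 0 < q → q ≤ r →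
      z + q • u ∈ interior K := by
    intro z hz r hr q hq hqr
    have := hK.add_smul_mem_interior hz hr (t := q / r)
      ⟨div_pos hq (hq.trans_le hqr), (div_le_one (hq.trans_le hqr)).2 hqr⟩
    rwa [smul_smul, div_mul_cancel₀ _ (hq.trans_le hqr).ne'] at this
  have hm : 0 < min s t := lt_min hs ht
  have := dist_lt_diam_of_mem_interior hb hpos (key x hx s hxs _ hm (min_le_left _ _))
    (interior_subset (key y hy t hyt _ hm (min_le_right _ _)))
  rwa [dist_add_right] at this

/-- A smooth convex body can be partitioned into parts of smaller diameter, one for each member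
of a given finite family of directions that positively spans the space. -/
theorem IsSmoothConvexBody.exists_partition_dist_le [CompleteSpace E] [Nontrivial E]
    {K : ConvexBody E} (hK : IsSmoothConvexBody K) (hpos : 0 < Metric.diam (K : Set E)) {m : ℕ}
    (hm : 0 < m) {u : Fin m → E} (hu : ∀ n : E, n ≠ 0 → ∃ i, inner ℝ n (u i) < 0) :
    ∃ f : K → Fin m, Function.Surjective f ∧ ∃ r, r < Metric.diam (K : Set E) ∧
      ∀ y y', f y = f y' → dist y y' ≤ r := by
  classical
  have : Nonempty (Fin m) := ⟨⟨0, hm⟩⟩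
  let U : Fin m → Set E := fun i => ⋃ t ∈ Set.Ioi (0 : ℝ), (· + t • u i) ⁻¹' interior (K : Set E)
  have hUopen : ∀ i, IsOpen (U i) := fun i =>
    isOpen_biUnion fun t _ => isOpen_interior.preimage (by fun_prop)
  have hUmem : ∀ i x, x ∈ U i ↔ ∃ t : ℝ, 0 < t ∧ x + t • u i ∈ interior (K : Set E) := by
    intro i x
    simp [U]
  have hcover : (K : Set E) ⊆ ⋃ i ∈ Finset.univ, U i := by
    intro x hx
    obtain ⟨i, hi⟩ := hK.exists_add_smul_mem_interior hu hx
    simp only [Finset.mem_univ, Set.iUnion_true, Set.mem_iUnion]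
    exact ⟨i, (hUmem i x).2 hi⟩
  -- The open illuminated sets are shrunk to compact ones, on which the supremum of distances is
  -- attained and so stays below the diameter.
  obtain ⟨C, hC, hCU, hCK⟩ :=
    K.isCompact.finite_compact_cover Finset.univ U (fun i _ => hUopen i) hcover
  obtain ⟨o, ho⟩ := hK.interior_nonempty
  have hinf : (interior (K : Set E)).Infinite :=
    have : (nhdsWithin o {o}ᶜ).NeBot := Module.punctured_nhds_neBot ℝ E o
    infinite_of_mem_nhds o (isOpen_interior.mem_nhds ho)
  -- The sets `C i` may be empty or overlap. Distinct interior points `p i`, which every direction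
  -- illuminates, are reserved one per part to make `f` surjective.
  let e := hinf.natEmbedding
  let p : Fin m → E := fun i => e i
  have hpint : ∀ i, p i ∈ interior (K : Set E) := fun i => (e i).2
  have hpinj : Function.Injective p := fun i j h => Fin.ext (e.injective (Subtype.ext h))
  have hpU : ∀ i, p i ∈ U i := fun i =>
    (hUmem i _).2 (exists_pos_add_smul_mem_of_isOpen isOpen_interior (hpint i) _)
  have hCK' : ∀ i, C i ⊆ K := by
    intro i x hx
    rw [hCK]
    simp only [Finset.mem_univ, Set.iUnion_true, Set.mem_iUnion]
    exact ⟨i, hx⟩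
  have hbound : ∀ i, ∃ r, r < Metric.diam (K : Set E) ∧
      ∀ x ∈ insert (p i) (C i), ∀ y ∈ insert (p i) (C i), dist x y ≤ r := by
    intro i
    have hsub : ∀ x ∈ insert (p i) (C i), x ∈ U i ∧ x ∈ (K : Set E) := by
      rintro x (rfl | hx)
      · exact ⟨hpU i, interior_subset (hpint i)⟩
      · exact ⟨hCU i hx, hCK' i hx⟩
    refine ((hC i).insert _).exists_forall_dist_le_of_lt hpos fun x hx y hy => ?_
    obtain ⟨s, hs, hxs⟩ := (hUmem i x).1 (hsub x hx).1
    obtain ⟨t, ht, hyt⟩ := (hUmem i y).1 (hsub y hy).1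
    exact dist_lt_diam_of_add_smul_mem_interior K.convex K.isBounded hpos (hsub x hx).2
      (hsub y hy).2 hs ht hxs hyt
  choose r hr hrd using hbound
  have hassign : ∀ y : K, ∃ i, (y : E) ∈ insert (p i) (C i) ∧ ∀ j, (y : E) = p j → i = j := by
    intro y
    by_cases hy : ∃ j, (y : E) = p j
    · obtain ⟨j, hj⟩ := hy
      exact ⟨j, Or.inl hj, fun j' hj' => hpinj (hj.symm.trans hj')⟩
    · have hyK : (y : E) ∈ (K : Set E) := y.2
      rw [hCK] at hyK
      simp only [Finset.mem_univ, Set.iUnion_true, Set.mem_iUnion] at hyK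
      obtain ⟨i, hi⟩ := hyK
      exact ⟨i, Or.inr hi, fun j hj => absurd ⟨j, hj⟩ hy⟩
  choose f hf hfp using hassign
  obtain ⟨i₀, hi₀⟩ := Finite.exists_max r
  refine ⟨f, fun i => ⟨⟨p i, interior_subset (hpint i)⟩, hfp _ i rfl⟩, r i₀, hr i₀, ?_⟩
  intro y y' hyy
  exact (hrd (f y) y (hf y) y' (hyy ▸ hf y')).trans (hi₀ _)

end Convex

theorem exists_positively_spanning (d : ℕ) :
    ∃ u : Fin (d + 1) → EuclideanSpace ℝ (Fin d),
      ∀ n : EuclideanSpace ℝ (Fin d), n ≠ 0 → ∃ i, inner ℝ n (u i) < 0 := by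
  let b : Fin d → EuclideanSpace ℝ (Fin d) := fun i => EuclideanSpace.single i 1
  -- If no product is negative, the coordinates of `n` are nonnegative with sum at most `0`, so `n =
  -- 0`.
  refine ⟨Fin.cons (-∑ i, b i) b, fun n hn => ?_⟩
  by_contra! h
  have hnn : ∀ i, 0 ≤ n i := fun i => by simpa [b, EuclideanSpace.inner_single_right] using h i.succ
  have hsum : ∑ i, n i ≤ 0 := by 
    simpa [b, inner_neg_right, inner_sum, EuclideanSpace.inner_single_right] using h 0
  have h0 := (Finset.sum_eq_zero_iff_of_nonneg fun i _ => hnn i).1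
    (le_antisymm hsum (Finset.sum_nonneg fun i _ => hnn i))
  exact hn (PiLp.ext fun i => h0 i (Finset.mem_univ i))

/-! ### The segment between the unit simplex and a smooth convex body -/

/-- The metric space of `k` points at mutual distances `2`. -/
def DoubleSimplex.{w'} (k : ℕ) : Type w' := ULift.{w'} (UnitSimplex k)

noncomputable instance (k : ℕ) : MetricSpace (DoubleSimplex.{w} k) where
  dist x y := 2 * dist x.down y.down
  dist_self x := by simp
  dist_comm x y := by rw [dist_comm]
  dist_triangle x y z := by linarith [dist_triangle x.down y.down z.down]
  eq_of_dist_eq_zero := by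
    intro x y h
    exact ULift.ext _ _ (dist_eq_zero.1 (by simpa using h))

theorem UnitSimplex.dist_of_ne {k : ℕ} {x y : UnitSimplex k} (h : x ≠ y) : dist x y = 1 :=
  if_neg h

theorem UnitSimplex.dist_le_one {k : ℕ} (x y : UnitSimplex k) : dist x y ≤ 1 := by
  rcases eq_or_ne x y with rfl | h
  · simp
  · exact (dist_of_ne h).le

theorem DoubleSimplex.dist_def {k : ℕ} (x y : DoubleSimplex.{w} k) :
    dist x y = 2 * dist x.down y.down := rfl

theorem UnitSimplex.nontrivial {k : ℕ} (hk : 1 < k) : Nontrivial (UnitSimplex k) :=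
  Fin.nontrivial_iff_two_le.2 hk

theorem UnitSimplex.ediamSpace_eq_one {k : ℕ} (hk : 1 < k) : ediamSpace (UnitSimplex k) = 1 := by
  have := nontrivial hk
  refine le_antisymm (Metric.ediam_le fun x _ y _ => ?_) ?_
  · rw [edist_dist, ← ENNReal.ofReal_one]
    exact ENNReal.ofReal_le_ofReal (dist_le_one x y)
  · obtain ⟨x, y, hxy⟩ := exists_pair_ne (UnitSimplex k)
    refine le_trans ?_ (Metric.edist_le_ediam_of_mem (Set.mem_univ x) (Set.mem_univ y))
    rw [edist_dist, dist_of_ne hxy, ENNReal.ofReal_one]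

section

variable {k : ℕ} {Y : Type u} [MetricSpace Y]

theorem ghEDist_unitSimplex_eq_half (hk : 1 < k) [Nonempty Y] [PreconnectedSpace Y]
    (hY : ∀ y y' : Y, dist y y' ≤ 1) :
    ghEDist (UnitSimplex k) Y = ENNReal.ofReal (1 / 2) := by
  have := UnitSimplex.nontrivial hk
  refine le_antisymm (ghEDist_le_of_dist_le (by norm_num) ?_ ?_)
    (le_ghEDist_of_separated_of_preconnected fun x x' h => (UnitSimplex.dist_of_ne h).ge)
  · exact fun x x' => by linarith [UnitSimplex.dist_le_one x x']
  · exact fun y y' => by linarith [hY y y']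

theorem ghEDist_doubleSimplex_eq_one (hk : 1 < k) [Nonempty Y] [PreconnectedSpace Y]
    (hY : ∀ y y' : Y, dist y y' ≤ 1) :
    ghEDist (DoubleSimplex.{w} k) Y = ENNReal.ofReal 1 := by
  have := UnitSimplex.nontrivial hk
  have : Nontrivial (DoubleSimplex.{w} k) := inferInstanceAs (Nontrivial (ULift (UnitSimplex k)))
  refine le_antisymm (ghEDist_le_of_dist_le (by norm_num) ?_ ?_) ?_
  · exact fun x x' => by
      rw [DoubleSimplex.dist_def]
      linarith [UnitSimplex.dist_le_one x.down x'.down]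
  · exact fun y y' => by linarith [hY y y']
  · have h := le_ghEDist_of_separated_of_preconnected (X := DoubleSimplex.{w} k) (Y := Y) (l := 2)
      fun x x' h => by
        rw [DoubleSimplex.dist_def, UnitSimplex.dist_of_ne fun h' => h (ULift.ext _ _ h')]
        norm_num
    simpa using h

/-- The bijection of vertices has distortion `1`, which is also the difference of the diameters. -/
theorem ghEDist_unitSimplex_doubleSimplex (hk : 1 < k) :
    ghEDist (UnitSimplex k) (DoubleSimplex.{w} k) = ENNReal.ofReal (1 / 2) := by
  have := UnitSimplex.nontrivial hk
  refine le_antisymm (ghEDist_le_of_correspondence (fun x y => x = y.down) (by norm_num)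
    (fun x => ⟨⟨x⟩, rfl⟩) (fun y => ⟨y.down, rfl⟩) ?_) ?_
  · rintro _ y _ y' rfl rfl
    rw [DoubleSimplex.dist_def, abs_le]
    constructor <;> linarith [UnitSimplex.dist_le_one y.down y'.down,
      dist_nonneg (x := y.down) (y := y'.down)]
  · obtain ⟨x, y, hxy⟩ := exists_pair_ne (UnitSimplex k)
    have h := le_ghEDist_of_dist_le (X := UnitSimplex k) (Y := DoubleSimplex.{w} k) (b := 2)
      UnitSimplex.dist_le_one (y := ⟨x⟩) (y' := ⟨y⟩) (by
        change 2 ≤ 2 * dist x y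
        rw [UnitSimplex.dist_of_ne hxy]; norm_num)
    norm_num at h ⊢
    exact h

theorem extendableBeyond_unitSimplex (hk : 1 < k) [Nonempty Y] [PreconnectedSpace Y]
    (hY : ∀ y y' : Y, dist y y' ≤ 1) : ExtendableBeyond.{w} Y (UnitSimplex k) := by
  refine ⟨DoubleSimplex.{w} k, inferInstance, ⟨⟨(⟨0, by omega⟩ : Fin k)⟩⟩, ⟨?_, ?_⟩, ?_⟩
  · rw [ghEDist_comm, ghEDist_doubleSimplex_eq_one hk hY]
    exact ENNReal.ofReal_lt_top
  · rw [ghEDist_comm (X := Y), ghEDist_comm (X := Y), ghEDist_doubleSimplex_eq_one hk hY,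
      ghEDist_unitSimplex_eq_half hk hY, ghEDist_unitSimplex_doubleSimplex hk,
      ← ENNReal.ofReal_add (by norm_num) (by norm_num)]
    norm_num
  · rw [ghEDist_unitSimplex_doubleSimplex hk]
    exact ENNReal.ofReal_pos.2 (by norm_num)

/-- A partition of `Y` into `k` parts of diameter at most `r < 1` composed with a correspondence
between `Y` and `Z` shows that `Z` is closer to the simplex than `1 / 2 + d_GH(Y, Z)`. -/
theorem ghEDist_unitSimplex_lt_of_partition [Nonempty (UnitSimplex k)] {Z : Type v} [MetricSpace Z]
    (hY : ∀ y y' : Y, dist y y' ≤ 1) {f : Y → UnitSimplex k} (hf : Function.Surjective f) {r : ℝ}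
    (hr : r < 1) (hfr : ∀ y y', f y = f y' → dist y y' ≤ r) (hpos : 0 < ghEDist Y Z)
    (hfin : ghEDist Y Z ≠ ∞) :
    ghEDist (UnitSimplex k) Z < ENNReal.ofReal (1 / 2) + ghEDist Y Z := by
  have hr0 : 0 ≤ r := by
    obtain ⟨x⟩ := ‹Nonempty (UnitSimplex k)›
    obtain ⟨y, -⟩ := hf x
    simpa using hfr y y rfl
  set δ := (ghEDist Y Z).toReal with hδ
  have hδpos : 0 < δ := ENNReal.toReal_pos hpos.ne' hfin
  have hδeq : ghEDist Y Z = ENNReal.ofReal δ := (ENNReal.ofReal_toReal hfin).symm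
  -- Distortion must stay within `1 + 2δ - 2η`. Inside a part, `r + 2δ + 2η` fits since `4η ≤ 1 -
  -- r`; across parts, `1 - dist z z' ≤ 1` fits since `η ≤ δ`.
  set η := min ((1 - r) / 4) δ with hη
  have hη0 : 0 < η := lt_min (by linarith) hδpos
  have hη1 : η ≤ (1 - r) / 4 := min_le_left _ _
  have hη2 : η ≤ δ := min_le_right _ _
  obtain ⟨R, hl, hs, hd⟩ := exists_correspondence_of_ghEDist_lt
    (hδeq ▸ (ENNReal.ofReal_lt_ofReal_iff (by positivity)).2 (by linarith) :
      ghEDist Y Z < ENNReal.ofReal (δ + η))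
  have hle : ghEDist (UnitSimplex k) Z ≤ ENNReal.ofReal (1 / 2 + δ - η) := by
    refine ghEDist_le_of_correspondence (fun x z => ∃ y, f y = x ∧ R y z) (by linarith)
      (fun x => ?_) (fun z => ?_) ?_
    · obtain ⟨y, hy⟩ := hf x
      obtain ⟨z, hz⟩ := hl y
      exact ⟨z, y, hy, hz⟩
    · obtain ⟨y, hy⟩ := hs z
      exact ⟨f y, y, rfl, hy⟩
    · rintro _ z _ z' ⟨y, rfl, hy⟩ ⟨y', rfl, hy'⟩
      obtain ⟨h1, -⟩ := abs_lt.1 (hd y z y' z' hy hy')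
      have hz : 0 ≤ dist z z' := dist_nonneg
      rw [abs_le]
      by_cases h : f y = f y'
      · rw [h, dist_self]
        constructor <;> linarith [hfr y y' h]
      · rw [UnitSimplex.dist_of_ne h]
        constructor <;> linarith [hY y y']
  rw [hδeq, ← ENNReal.ofReal_add (by norm_num) hδpos.le]
  exact hle.trans_lt ((ENNReal.ofReal_lt_ofReal_iff (by positivity)).2 (by linarith))

end

theorem mainTheorem6 (k : ℕ) (hk : 1 < k)
    (Y : ConvexBody (EuclideanSpace ℝ (Fin (k - 1))))
    (hY : IsSmoothConvexBody Y)
    (hdiam : Metric.diam (Y : Set (EuclideanSpace ℝ (Fin (k - 1)))) = 1) :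
    partitionAlpha k Y = 0 ∧
    partitionDiam k Y < 1 ∧
    2 * ghEDist (UnitSimplex k) Y = 1 ∧
    IsExtremeSegment (UnitSimplex k) Y ∧
    ExtendableBeyond.{w} Y (UnitSimplex k) ∧
    ¬ ExtendableBeyond.{w} (UnitSimplex k) Y := by
  have hconn : PreconnectedSpace Y := Subtype.preconnectedSpace Y.convex.isPreconnected
  have hne : Nonempty Y := Y.nonempty.to_subtype
  have hsimplex := UnitSimplex.nontrivial hk
  have hdist : ∀ y y' : Y, dist y y' ≤ 1 := fun y y' =>
    hdiam ▸ Metric.dist_le_diam_of_mem Y.isBounded y.2 y'.2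
  have hediam : ediamSpace Y = 1 := by
    have h : Metric.ediam (Set.univ : Set Y)
        = Metric.ediam (Y : Set (EuclideanSpace ℝ (Fin (k - 1)))) := by
      rw [← isometry_subtype_coe.ediam_image, Set.image_univ, Subtype.range_coe]
    rw [ediamSpace, h, ← ENNReal.ofReal_toReal Y.isBounded.ediam_ne_top]
    change ENNReal.ofReal (Metric.diam _) = 1
    rw [hdiam, ENNReal.ofReal_one]
  have hgh := ghEDist_unitSimplex_eq_half hk hdist
  have htwo : 2 * ghEDist (UnitSimplex k) Y = 1 := by
    rw [hgh, ← ENNReal.ofReal_ofNat 2, ← ENNReal.ofReal_mul (by norm_num)]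
    norm_num
  obtain ⟨f, hf, r, hr, hfr⟩ : ∃ f : Y → Fin k, Function.Surjective f ∧ ∃ r : ℝ, r < 1 ∧
      ∀ y y', f y = f y' → dist y y' ≤ r := by
    have : Nontrivial (EuclideanSpace ℝ (Fin (k - 1))) := by
      have : Nonempty (Fin (k - 1)) := ⟨⟨0, by omega⟩⟩
      infer_instance
    obtain ⟨u, hu⟩ : ∃ u : Fin k → EuclideanSpace ℝ (Fin (k - 1)),
        ∀ n : EuclideanSpace ℝ (Fin (k - 1)), n ≠ 0 → ∃ i, inner ℝ n (u i) < 0 := by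
      obtain ⟨d, rfl⟩ : ∃ d, k = d + 1 := ⟨k - 1, by omega⟩
      exact exists_positively_spanning d
    rw [← hdiam]
    exact hY.exists_partition_dist_le (by rw [hdiam]; exact one_pos) (by omega) hu
  refine ⟨partitionAlpha_eq_zero_of_preconnected hk, ?_, htwo, ?_,
    extendableBeyond_unitSimplex hk hdist, ?_⟩
  · refine (partitionDiam_le hf hfr).trans_lt ?_
    rw [← ENNReal.ofReal_one]
    exact (ENNReal.ofReal_lt_ofReal_iff one_pos).2 hr
  · have hX := UnitSimplex.ediamSpace_eq_one hk
    exact ⟨by rw [hX]; exact ENNReal.one_lt_top, by rw [hediam]; exact ENNReal.one_lt_top,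
      by rw [htwo, hediam], by rw [hediam, hX], by rw [hX]; exact one_pos⟩
  · rintro ⟨Z, _, -, ⟨hfin, heq⟩, hpos⟩
    -- Finiteness of `d_GH(Y, Z)` follows from that of the whole segment; the strict inequality then
    -- contradicts additivity.
    have hYZ : ghEDist Y Z ≠ ∞ := ((le_add_self.trans heq.le).trans_lt hfin).ne
    refine (ghEDist_unitSimplex_lt_of_partition (f := f) hdist hf hr hfr hpos hYZ).ne ?_
    rw [← heq, hgh]
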